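/- Let $F$ be a field, $D\ge 0$ an integer, and $R=F[x_1^{\pm},\dots,x_D^{\pm}]$ with the $F$-linear involution $f\mapsto\bar f$ determined by $\bar x_j=x_j^{-1}$. For a matrix $M$ over $R$ let $M^\dagger$ be the transpose of the matrix obtained by applying the involution to every entry. Consider the invertible matrices $\Xi$ over $R$, of any finite size $m\times m$ with $m\ge 0$, which are antihermitian, $\Xi^\dagger=-\Xi$, and whose diagonal entries have zero constant term (this last condition is automatic if $\operatorname{char}F\ne 2$). Put $\lambda_n=\begin{pmatrix}0&I_n\\-I_n&0\end{pmatrix}$. Call $\Xi$ and $\Xi'$ equivalent if there are integers $n,n'\ge 0$ and an invertible matrix $E$ over $R$ with $E^\dagger(\Xi\oplus\lambda_n)E=\Xi'\oplus\lambda_{n'}$. The equivalence classes form an abelian group under the direct sum $\oplus$, the Witt group of invertible antihermitian matrices over $R$; its zero element is the common class of all the $\lambda_n$, including the empty matrix $\lambda_0$. Lemma. (1) For every field $F$, the Witt group of antihermitian matrices over $F$ (the case $D=0$) is trivial. (2) For every finite field $F$ (of any characteristic, including 2), the Witt group of antihermitian matrices over $F[x^{\pm}]$ (the case $D=1$) is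 trivial. In other words, in both cases, for every such $\Xi$ there are $n,n'\ge 0$ such that $\Xi\oplus\lambda_n$ is congruent to $\lambda_{n'}$. -/

import Mathlib

open Matrix

noncomputable section

namespace LaurentWitt

/-- The Laurent polynomial ring `R = F[x₁^±, …, x_D^±]`, i.e. the group algebra of `ℤ^D`.
The coefficient of the monomial `x^a` in `f` is `f.coeff a`. -/
abbrev LaurentRing (F : Type*) [Field F] (D : ℕ) : Type _ :=
  AddMonoidAlgebra F (Fin D → ℤ)

variable {F : Type*} [Field F] {D : ℕ}

/-- The `F`-linear involution of `R` with `x_j ↦ x_j⁻¹`. -/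
def bar : LaurentRing F D ≃ₐ[F] LaurentRing F D :=
  AddMonoidAlgebra.domCongr F F (AddEquiv.neg (Fin D → ℤ))

/-- The constant term of a Laurent polynomial. -/
def constTerm (f : LaurentRing F D) : F := f.coeff 0

/-- `M†`: the transpose followed by the involution `x_j ↦ x_j⁻¹` on every entry. -/
def dagger {m n : Type*} (M : Matrix m n (LaurentRing F D)) : Matrix n m (LaurentRing F D) :=
  (M.map bar)ᵀ

/-- The hyperbolic form `λ_n = ((0, I_n), (-I_n, 0))`. -/
def hyperbolic (F : Type*) [Field F] (D n : ℕ) :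
    Matrix (Fin n ⊕ Fin n) (Fin n ⊕ Fin n) (LaurentRing F D) :=
  fromBlocks 0 1 (-1) 0

/-- The orthogonal (block diagonal) sum `A ⊕ B`. -/
def dsum {m n : Type*} (A : Matrix m m (LaurentRing F D)) (B : Matrix n n (LaurentRing F D)) :
    Matrix (m ⊕ n) (m ⊕ n) (LaurentRing F D) :=
  fromBlocks A 0 0 B

/-- Congruence: `E† A E = B` for some invertible matrix `E` over `R`. The index types may differ,
so `E` is invertible when it has a two-sided inverse `E'`. -/
def Congruent {m n : Type*} [Fintype m] [DecidableEq m] [Fintype n] [DecidableEq n]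
    (A : Matrix m m (LaurentRing F D)) (B : Matrix n n (LaurentRing F D)) : Prop :=
  ∃ (E : Matrix m n (LaurentRing F D)) (E' : Matrix n m (LaurentRing F D)),
    E * E' = 1 ∧ E' * E = 1 ∧ dagger E * A * E = B

/-- Invertible antihermitian matrices over `R`, of any finite dimension,
with zero constant terms in the diagonal. -/
structure AntihermitianForm (F : Type*) [Field F] (D : ℕ) where
  dim : ℕ
  mat : Matrix (Fin dim) (Fin dim) (LaurentRing F D)
  antihermitian : dagger mat = -mat
  invertible : IsUnit mat
  constTerm_diag : ∀ i, constTerm (mat i i) = 0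

/-- `Ξ ≃ Ξ'`: there are `n, n'` such that `Ξ ⊕ λ_n` and `Ξ' ⊕ λ_n'` are congruent. -/
def StablyEquivalent (X Y : AntihermitianForm F D) : Prop :=
  ∃ n n' : ℕ, Congruent (dsum X.mat (hyperbolic F D n)) (dsum Y.mat (hyperbolic F D n'))

section Involution

@[simp] theorem coeff_bar (f : LaurentRing F D) (a : Fin D → ℤ) :
    (bar f).coeff a = f.coeff (-a) := by
  simp [bar]

@[simp] theorem bar_bar (f : LaurentRing F D) : bar (bar f) = f := by
  ext a; simp

@[simp] theorem constTerm_zero : constTerm (0 : LaurentRing F D) = 0 := by simp [constTerm]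

@[simp] theorem constTerm_neg (f : LaurentRing F D) : constTerm (-f) = -constTerm f := by
  simp [constTerm]

variable {l m n : Type*}

@[simp] theorem dagger_apply (M : Matrix m n (LaurentRing F D)) (i : n) (j : m) :
    dagger M i j = bar (M j i) := rfl

theorem dagger_dagger (M : Matrix m n (LaurentRing F D)) : dagger (dagger M) = M := by
  ext1 i j; simp

theorem dagger_mul [Fintype m] (M : Matrix l m (LaurentRing F D))
    (N : Matrix m n (LaurentRing F D)) : dagger (M * N) = dagger N * dagger M := by
  ext1 i j
  simp [Matrix.mul_apply, map_sum, map_mul, mul_comm]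

theorem dagger_neg (M : Matrix m n (LaurentRing F D)) : dagger (-M) = -dagger M := by
  ext1 i j; simp

theorem dagger_add (M N : Matrix m n (LaurentRing F D)) :
    dagger (M + N) = dagger M + dagger N := by
  ext1 i j; simp

theorem dagger_sub (M N : Matrix m n (LaurentRing F D)) :
    dagger (M - N) = dagger M - dagger N := by
  ext1 i j; simp

theorem dagger_zero : dagger (0 : Matrix m n (LaurentRing F D)) = 0 := by
  ext1 i j; simp

theorem dagger_one [DecidableEq m] : dagger (1 : Matrix m m (LaurentRing F D)) = 1 := by
  ext1 i j
  by_cases h : i = j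
  · subst h; simp
  · simp [Matrix.one_apply_ne h, Matrix.one_apply_ne (Ne.symm h)]

theorem dagger_fromBlocks {o : Type*} (A : Matrix n l (LaurentRing F D))
    (B : Matrix n m (LaurentRing F D)) (C : Matrix o l (LaurentRing F D))
    (E : Matrix o m (LaurentRing F D)) :
    dagger (fromBlocks A B C E) = fromBlocks (dagger A) (dagger C) (dagger B) (dagger E) := by
  ext1 i j
  rcases i with i | i <;> rcases j with j | j <;> rfl

end Involution

section Congruence

variable {k l m n : Type*} [Fintype k] [DecidableEq k] [Fintype l] [DecidableEq l]
  [Fintype m] [DecidableEq m] [Fintype n] [DecidableEq n]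

theorem Congruent.symm {A : Matrix m m (LaurentRing F D)} {B : Matrix n n (LaurentRing F D)}
    (h : Congruent A B) : Congruent B A := by
  obtain ⟨E, E', h1, h2, rfl⟩ := h
  refine ⟨E', E, h2, h1, ?_⟩
  calc dagger E' * (dagger E * A * E) * E'
      = dagger (E * E') * A * (E * E') := by rw [dagger_mul]; simp only [Matrix.mul_assoc]
    _ = A := by rw [h1, dagger_one, Matrix.one_mul, Matrix.mul_one]

theorem Congruent.trans {A : Matrix l l (LaurentRing F D)} {B : Matrix m m (LaurentRing F D)}
    {C : Matrix n n (LaurentRing F D)} (h : Congruent A B) (h' : Congruent B C) :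
    Congruent A C := by
  obtain ⟨E, E', h1, h2, rfl⟩ := h
  obtain ⟨G, G', h3, h4, rfl⟩ := h'
  refine ⟨E * G, G' * E', ?_, ?_, ?_⟩
  · calc E * G * (G' * E') = E * (G * G') * E' := by simp only [Matrix.mul_assoc]
      _ = 1 := by rw [h3, Matrix.mul_one, h1]
  · calc G' * E' * (E * G) = G' * (E' * E) * G := by simp only [Matrix.mul_assoc]
      _ = 1 := by rw [h2, Matrix.mul_one, h4]
  · rw [dagger_mul]; simp only [Matrix.mul_assoc]

theorem congruent_submatrix (A : Matrix m m (LaurentRing F D)) (e : n ≃ m) :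
    Congruent A (A.submatrix e e) := by
  refine ⟨(1 : Matrix m m (LaurentRing F D)).submatrix id e,
    (1 : Matrix m m (LaurentRing F D)).submatrix e id, ?_, ?_, ?_⟩
  · rw [Matrix.submatrix_mul_equiv]; simp
  · have := Matrix.submatrix_mul_equiv (1 : Matrix m m (LaurentRing F D)) 1 e (Equiv.refl m) e
    simp only [Equiv.coe_refl] at this
    rw [this, Matrix.mul_one, Matrix.submatrix_one_equiv]
  · have hd : dagger ((1 : Matrix m m (LaurentRing F D)).submatrix id e)
        = (1 : Matrix m m (LaurentRing F D)).submatrix e id := by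
      conv_rhs => rw [← dagger_one]
      rfl
    rw [hd]
    have h1 := Matrix.submatrix_mul_equiv (1 : Matrix m m (LaurentRing F D)) A e (Equiv.refl m) id
    have h2 := Matrix.submatrix_mul_equiv A (1 : Matrix m m (LaurentRing F D)) e (Equiv.refl m) e
    simp only [Equiv.coe_refl, Matrix.submatrix_id_id] at h1 h2
    rw [h1, Matrix.one_mul, h2, Matrix.mul_one]

theorem Congruent.refl (A : Matrix m m (LaurentRing F D)) : Congruent A A :=
  congruent_submatrix A (Equiv.refl m)

theorem congruent_of_submatrix {A : Matrix m m (LaurentRing F D)}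
    {B : Matrix n n (LaurentRing F D)} (e : n ≃ m) (h : B = A.submatrix e e) : Congruent A B :=
  h ▸ congruent_submatrix A e

theorem Congruent.dsum {A : Matrix k k (LaurentRing F D)} {B : Matrix l l (LaurentRing F D)}
    {A' : Matrix m m (LaurentRing F D)} {B' : Matrix n n (LaurentRing F D)}
    (h : Congruent A A') (h' : Congruent B B') :
    Congruent (dsum A B) (dsum A' B') := by
  obtain ⟨E, E', h1, h2, rfl⟩ := h
  obtain ⟨G, G', h3, h4, rfl⟩ := h'
  refine ⟨fromBlocks E 0 0 G, fromBlocks E' 0 0 G', ?_, ?_, ?_⟩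
  · simp [fromBlocks_multiply, h1, h3]
  · simp [fromBlocks_multiply, h2, h4]
  · simp [LaurentWitt.dsum, dagger_fromBlocks, fromBlocks_multiply, dagger_zero]

theorem Congruent.neg {A : Matrix m m (LaurentRing F D)} {B : Matrix n n (LaurentRing F D)}
    (h : Congruent A B) : Congruent (-A) (-B) := by
  obtain ⟨E, E', h1, h2, rfl⟩ := h
  exact ⟨E, E', h1, h2, by simp⟩

theorem congruent_dsum_comm (A : Matrix m m (LaurentRing F D)) (B : Matrix n n (LaurentRing F D)) :
    Congruent (dsum A B) (dsum B A) := by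
  refine congruent_of_submatrix (Equiv.sumComm n m) ?_
  ext1 i j
  rcases i with i | i <;> rcases j with j | j <;> rfl

theorem congruent_dsum_assoc (A : Matrix l l (LaurentRing F D)) (B : Matrix m m (LaurentRing F D))
    (C : Matrix n n (LaurentRing F D)) :
    Congruent (dsum (dsum A B) C) (dsum A (dsum B C)) := by
  refine congruent_of_submatrix (Equiv.sumAssoc l m n).symm ?_
  ext1 i j
  rcases i with i | i | i <;> rcases j with j | j | j <;> rfl

theorem congruent_dsum_comm4 (A : Matrix k k (LaurentRing F D))
    (B : Matrix l l (LaurentRing F D)) (A' : Matrix m m (LaurentRing F D))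
    (B' : Matrix n n (LaurentRing F D)) :
    Congruent (dsum (dsum A B) (dsum A' B')) (dsum (dsum A A') (dsum B B')) := by
  refine congruent_of_submatrix (Equiv.sumSumSumComm k m l n) ?_
  ext1 i j
  rcases i with (i | i) | (i | i) <;> rcases j with (j | j) | (j | j) <;> rfl

theorem congruent_dsum_empty [IsEmpty n] (A : Matrix m m (LaurentRing F D))
    (B : Matrix n n (LaurentRing F D)) : Congruent (dsum B A) A := by
  refine congruent_of_submatrix (Equiv.emptySum n m).symm ?_
  ext1 i j
  rfl

theorem congruent_hyperbolic_add (a b : ℕ) :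
    Congruent (dsum (hyperbolic F D a) (hyperbolic F D b)) (hyperbolic F D (a + b)) := by
  refine Congruent.symm (congruent_of_submatrix ((Equiv.sumSumSumComm _ _ _ _).trans
    (Equiv.sumCongr finSumFinEquiv finSumFinEquiv)) ?_)
  ext1 i j
  rcases i with (i | i) | (i | i) <;> rcases j with (j | j) | (j | j) <;>
    simp [dsum, hyperbolic, Matrix.one_apply, Fin.ext_iff] <;> omega

theorem congruent_neg_hyperbolic (a : ℕ) :
    Congruent (-hyperbolic F D a) (hyperbolic F D a) := by
  refine congruent_of_submatrix (Equiv.sumComm _ _) ?_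
  ext1 i j
  rcases i with i | i <;> rcases j with j | j <;> simp [hyperbolic]

end Congruence

section StableEquivalence

theorem StablyEquivalent.refl (X : AntihermitianForm F D) : StablyEquivalent X X :=
  ⟨0, 0, Congruent.refl _⟩

theorem StablyEquivalent.symm {X Y : AntihermitianForm F D} (h : StablyEquivalent X Y) :
    StablyEquivalent Y X := by
  obtain ⟨n, n', h⟩ := h
  exact ⟨n', n, h.symm⟩

/-- `(A ⊕ λ_a) ⊕ λ_b ≅ A ⊕ λ_{a+b}`. -/
theorem congruent_stabilize {m : Type*} [Fintype m] [DecidableEq m]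
    (A : Matrix m m (LaurentRing F D)) (a b : ℕ) :
    Congruent (dsum (dsum A (hyperbolic F D a)) (hyperbolic F D b))
      (dsum A (hyperbolic F D (a + b))) :=
  (congruent_dsum_assoc _ _ _).trans ((Congruent.refl A).dsum (congruent_hyperbolic_add a b))

theorem StablyEquivalent.trans {X Y Z : AntihermitianForm F D} (h : StablyEquivalent X Y)
    (h' : StablyEquivalent Y Z) : StablyEquivalent X Z := by
  obtain ⟨a, a', h⟩ := h
  obtain ⟨b, b', h'⟩ := h'
  refine ⟨a + b, b' + a', ?_⟩
  have h1 := (congruent_stabilize X.mat a b).symm.trans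
    ((h.dsum (Congruent.refl (hyperbolic F D b))).trans (congruent_stabilize Y.mat a' b))
  have h2 := (congruent_stabilize Y.mat b a').symm.trans
    ((h'.dsum (Congruent.refl (hyperbolic F D a'))).trans (congruent_stabilize Z.mat b' a'))
  rw [Nat.add_comm a' b] at h1
  exact h1.trans h2

instance stableSetoid (F : Type*) [Field F] (D : ℕ) : Setoid (AntihermitianForm F D) where
  r := StablyEquivalent
  iseqv := ⟨StablyEquivalent.refl, StablyEquivalent.symm, StablyEquivalent.trans⟩

theorem StablyEquivalent.of_congruent {X Y : AntihermitianForm F D} (h : Congruent X.mat Y.mat) :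
    StablyEquivalent X Y :=
  ⟨0, 0, h.dsum (Congruent.refl _)⟩

/-- The zero-dimensional form. -/
def zeroForm (F : Type*) [Field F] (D : ℕ) : AntihermitianForm F D where
  dim := 0
  mat := 0
  antihermitian := by ext i; exact i.elim0
  invertible := by rw [Subsingleton.elim (0 : Matrix (Fin 0) (Fin 0) (LaurentRing F D)) 1]
                   exact isUnit_one
  constTerm_diag i := i.elim0

/-- The form `-Ξ`. -/
def negForm (X : AntihermitianForm F D) : AntihermitianForm F D where
  dim := X.dim
  mat := -X.mat
  antihermitian := by rw [dagger_neg, X.antihermitian]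
  invertible := X.invertible.neg
  constTerm_diag i := by simp [X.constTerm_diag i]

/-- The orthogonal sum `Ξ ⊕ Ξ'`, with rows and columns numbered consecutively. -/
def addForm (X Y : AntihermitianForm F D) : AntihermitianForm F D where
  dim := X.dim + Y.dim
  mat := (dsum X.mat Y.mat).submatrix finSumFinEquiv.symm finSumFinEquiv.symm
  antihermitian := by
    have h : dagger (dsum X.mat Y.mat) = -dsum X.mat Y.mat := by
      rw [dsum, dagger_fromBlocks, X.antihermitian, Y.antihermitian, dagger_zero, dagger_zero,
        fromBlocks_neg]
      simp
    ext1 i j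
    exact congrFun (congrFun h (finSumFinEquiv.symm i)) (finSumFinEquiv.symm j)
  invertible := by
    rw [Matrix.isUnit_submatrix_equiv, dsum, Matrix.isUnit_iff_isUnit_det, det_fromBlocks_zero₁₂]
    exact ((Matrix.isUnit_iff_isUnit_det _).1 X.invertible).mul
      ((Matrix.isUnit_iff_isUnit_det _).1 Y.invertible)
  constTerm_diag i := by
    rw [submatrix_apply]
    rcases finSumFinEquiv.symm i with i | i
    · exact X.constTerm_diag i
    · exact Y.constTerm_diag i

theorem congruent_addForm (X Y : AntihermitianForm F D) :
    Congruent (dsum X.mat Y.mat) (addForm X Y).mat :=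
  congruent_submatrix _ _

theorem addForm_stable {X X' Y Y' : AntihermitianForm F D} (h : StablyEquivalent X X')
    (h' : StablyEquivalent Y Y') : StablyEquivalent (addForm X Y) (addForm X' Y') := by
  have key : ∀ (X Y : AntihermitianForm F D) (a b : ℕ),
      Congruent (dsum (dsum X.mat (hyperbolic F D a)) (dsum Y.mat (hyperbolic F D b)))
        (dsum (addForm X Y).mat (hyperbolic F D (a + b))) := fun X Y a b =>
    (congruent_dsum_comm4 _ _ _ _).trans
      ((congruent_addForm X Y).dsum (congruent_hyperbolic_add a b))
  obtain ⟨a, a', h⟩ := h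
  obtain ⟨b, b', h'⟩ := h'
  exact ⟨a + b, a' + b', (key X Y a b).symm.trans ((h.dsum h').trans (key X' Y' a' b'))⟩

theorem negForm_stable {X X' : AntihermitianForm F D} (h : StablyEquivalent X X') :
    StablyEquivalent (negForm X) (negForm X') := by
  have key : ∀ (X : AntihermitianForm F D) (a : ℕ),
      Congruent (-dsum X.mat (hyperbolic F D a)) (dsum (negForm X).mat (hyperbolic F D a)) := by
    intro X a
    have : -dsum X.mat (hyperbolic F D a) = dsum (negForm X).mat (-hyperbolic F D a) := by
      rw [dsum, fromBlocks_neg, neg_zero, neg_zero]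
      rfl
    rw [this]
    exact (Congruent.refl _).dsum (congruent_neg_hyperbolic a)
  obtain ⟨a, a', h⟩ := h
  exact ⟨a, a', (key X a).symm.trans (h.neg.trans (key X' a'))⟩

/-- An antihermitian Laurent polynomial without constant term is of the form `g - ḡ`. -/
theorem exists_sub_bar (f : LaurentRing F D) (h : bar f = -f) (h0 : constTerm f = 0) :
    ∃ g : LaurentRing F D, f = g - bar g := by
  classical
  refine ⟨AddMonoidAlgebra.ofCoeff (f.coeff.filter (fun a => 0 < toLex a)), ?_⟩
  have hf : ∀ a, f.coeff (-a) = -f.coeff a := fun a => by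
    rw [← coeff_bar, h]; rfl
  ext a
  rw [AddMonoidAlgebra.coeff_sub, Finsupp.sub_apply, coeff_bar]
  have hneg : 0 < toLex (-a) ↔ toLex a < 0 := by
    rw [toLex_neg, Left.neg_pos_iff]
  rcases lt_trichotomy (toLex a) 0 with hlt | heq | hgt
  · rw [AddMonoidAlgebra.coeff_ofCoeff, Finsupp.filter_apply_neg (fun a : Fin D → ℤ => 0 < toLex a) _ hlt.not_gt,
      Finsupp.filter_apply_pos (fun a : Fin D → ℤ => 0 < toLex a) _ (hneg.2 hlt), hf, zero_sub, neg_neg]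
  · have ha : a = 0 := toLex.injective heq
    subst ha
    rw [AddMonoidAlgebra.coeff_ofCoeff, neg_zero, sub_self]
    exact h0
  · rw [AddMonoidAlgebra.coeff_ofCoeff, Finsupp.filter_apply_pos (fun a : Fin D → ℤ => 0 < toLex a) _ hgt,
      Finsupp.filter_apply_neg (fun a : Fin D → ℤ => 0 < toLex a) _ (fun h => hgt.not_gt (hneg.1 h)), sub_zero]

/-- An antihermitian matrix without constant terms in the diagonal is of the form `M - M†`. -/
theorem exists_sub_dagger (X : AntihermitianForm F D) :
    ∃ M : Matrix (Fin X.dim) (Fin X.dim) (LaurentRing F D), X.mat = M - dagger M := by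
  have hX : ∀ i j, bar (X.mat j i) = -X.mat i j := fun i j =>
    congrFun (congrFun X.antihermitian i) j
  choose g hg using fun i => exists_sub_bar (X.mat i i) (hX i i) (X.constTerm_diag i)
  refine ⟨Matrix.of fun i j => if i < j then X.mat i j else if i = j then g i else 0, ?_⟩
  ext1 i j
  rw [Matrix.sub_apply, dagger_apply, Matrix.of_apply, Matrix.of_apply]
  rcases lt_trichotomy i j with h | h | h
  · simp [h, h.not_gt, h.ne']
  · subst h; simpa using hg i
  · simp [h, h.not_gt, h.ne', hX]

/-- `Ξ ⊕ (-Ξ)` is congruent to a hyperbolic form. -/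
theorem congruent_dsum_neg (X : AntihermitianForm F D) :
    Congruent (dsum X.mat (-X.mat)) (hyperbolic F D X.dim) := by
  obtain ⟨M, hM⟩ := exists_sub_dagger X
  obtain ⟨U, hU⟩ := X.invertible
  set N : Matrix (Fin X.dim) (Fin X.dim) (LaurentRing F D) := 
    ((U⁻¹ : (Matrix (Fin X.dim) (Fin X.dim) (LaurentRing F D))ˣ) :
      Matrix (Fin X.dim) (Fin X.dim) (LaurentRing F D)) with hN
  have hXN : X.mat * N = 1 := by rw [← hU, hN]; exact U.mul_inv
  have hNX : N * X.mat = 1 := by rw [← hU, hN]; exact U.inv_mul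
  have hNd : dagger N = -N := by
    have h1 : dagger N * X.mat = -1 := by
      have := congrArg dagger hXN
      rw [dagger_mul, X.antihermitian, dagger_one] at this
      rw [← this]; simp
    calc dagger N = dagger N * X.mat * N := by rw [Matrix.mul_assoc, hXN, Matrix.mul_one]
      _ = -N := by rw [h1]; simp
  obtain ⟨a, ha⟩ : ∃ a, a - dagger a = N := by
    refine ⟨N * M * N, ?_⟩
    rw [dagger_mul, dagger_mul, hNd]
    calc N * M * N - -N * (dagger M * -N) = N * (M - dagger M) * N := by noncomm_ring
      _ = N := by rw [← hM, hNX, Matrix.one_mul]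
  have hGE : dagger (fromBlocks 1 a 1 (a - N)) * dsum X.mat (-X.mat) * fromBlocks 1 a 1 (a - N)
      = hyperbolic F D X.dim := by
    rw [dagger_fromBlocks, dsum, fromBlocks_multiply, fromBlocks_multiply, hyperbolic,
      dagger_one, dagger_sub, hNd]
    congr 1
    · noncomm_ring
    · calc _ = X.mat * N := by noncomm_ring
        _ = 1 := hXN
    · calc _ = -(N * X.mat) := by noncomm_ring
        _ = -1 := by rw [hNX]
    · calc _ = dagger a * (X.mat * N) - (N * X.mat) * a + N * X.mat * N := by noncomm_ring
        _ = N - (a - dagger a) := by rw [hXN, hNX]; noncomm_ring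
        _ = 0 := by rw [ha, sub_self]
  set E : Matrix (Fin X.dim ⊕ Fin X.dim) (Fin X.dim ⊕ Fin X.dim) (LaurentRing F D) :=
    fromBlocks 1 a 1 (a - N) with hE
  have hL : (-hyperbolic F D X.dim) * hyperbolic F D X.dim = 1 := by
    simp [hyperbolic, fromBlocks_neg, fromBlocks_multiply]
  have hinv : (-hyperbolic F D X.dim * dagger E * dsum X.mat (-X.mat)) * E = 1 := by
    rw [Matrix.mul_assoc (-hyperbolic F D X.dim), Matrix.mul_assoc (-hyperbolic F D X.dim),
      hGE, hL]
  exact ⟨E, _, mul_eq_one_comm.1 hinv, hinv, hGE⟩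

end StableEquivalence

/-- The Witt group of invertible antihermitian matrices (with zero constant terms in the diagonal)
over `F[x₁^±, …, x_D^±]`: the stable equivalence classes, with the orthogonal sum as addition. -/
def WittGroup (F : Type*) [Field F] (D : ℕ) : Type _ := Quotient (stableSetoid F D)

instance (F : Type*) [Field F] (D : ℕ) : Zero (WittGroup F D) :=
  ⟨Quotient.mk _ (zeroForm F D)⟩

instance (F : Type*) [Field F] (D : ℕ) : Add (WittGroup F D) :=
  ⟨Quotient.map₂ addForm fun _ _ h _ _ h' => addForm_stable h h'⟩

instance (F : Type*) [Field F] (D : ℕ) : Neg (WittGroup F D) :=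
  ⟨Quotient.map negForm fun _ _ h => negForm_stable h⟩

instance (F : Type*) [Field F] (D : ℕ) : AddCommGroup (WittGroup F D) where
  nsmul := nsmulRec
  zsmul := zsmulRec
  add_assoc := by
    rintro ⟨X⟩ ⟨Y⟩ ⟨Z⟩
    refine Quotient.sound (StablyEquivalent.of_congruent ?_)
    exact (congruent_addForm _ _).symm.trans
      (((congruent_addForm X Y).symm.dsum (Congruent.refl _)).trans
        ((congruent_dsum_assoc _ _ _).trans
          (((Congruent.refl _).dsum (congruent_addForm Y Z)).trans (congruent_addForm _ _))))
  zero_add := by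
    rintro ⟨X⟩
    refine Quotient.sound (StablyEquivalent.of_congruent ?_)
    have : IsEmpty (Fin (zeroForm F D).dim) := Fin.isEmpty
    exact (congruent_addForm _ _).symm.trans (congruent_dsum_empty _ _)
  add_zero := by
    rintro ⟨X⟩
    refine Quotient.sound (StablyEquivalent.of_congruent ?_)
    have : IsEmpty (Fin (zeroForm F D).dim) := Fin.isEmpty
    exact (congruent_addForm _ _).symm.trans
      ((congruent_dsum_comm _ _).trans (congruent_dsum_empty _ _))
  add_comm := by
    rintro ⟨X⟩ ⟨Y⟩
    refine Quotient.sound (StablyEquivalent.of_congruent ?_)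
    exact (congruent_addForm _ _).symm.trans
      ((congruent_dsum_comm _ _).trans (congruent_addForm _ _))
  neg_add_cancel := by
    rintro ⟨X⟩
    refine Quotient.sound ⟨0, X.dim, ?_⟩
    have : IsEmpty (Fin (zeroForm F D).dim) := Fin.isEmpty
    have : IsEmpty (Fin 0 ⊕ Fin 0) := inferInstance
    exact (congruent_dsum_comm _ _).trans ((congruent_dsum_empty _ _).trans
      ((congruent_addForm _ _).symm.trans ((congruent_dsum_comm _ _).trans
        ((congruent_dsum_neg X).trans (congruent_dsum_empty _ _).symm))))

end LaurentWitt

end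

/-! The Witt group vanishes as soon as every nonempty form has a nonzero isotropic vector. Indeed,
for D ≤ 1 the ring R is a principal ideal domain, so an isotropic vector can be divided by the gcd
of its entries and becomes unimodular. A unimodular isotropic vector lies in a hyperbolic pair, the
plane it spans splits off, and the orthogonal complement is again free; induction on the dimension
finishes (`subsingleton_wittGroup_of_isotropic`). The condition on the diagonal enters through
`exists_sub_dagger`: every value v†Ξv has the form g - ḡ, which replaces division by 2 and makes the
argument uniform in the characteristic.

For D = 0 the involution is trivial, so g - ḡ = 0 and every vector is isotropic.

For D = 1 and F finite, isotropy depends on the dimension. Dimension 1 does not occur: the only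
entry g - ḡ vanishes at x = 1, so it is not a unit. In dimension 2 the determinant is a symmetric
unit, hence a constant, and evaluation at x = 1 shows that it is a square; this gives an explicit
isotropic vector. In dimension at least 3, let v have polynomial entries of degree at most 2d, where
d bounds the exponents in Ξ. Since v†Ξv is antihermitian without constant term, it vanishes once its
coefficients at x, …, x^{3d} do. These are 3d quadratic equations in at least 3(2d+1) > 2·3d
unknowns, so Chevalley–Warning provides a nonzero solution. -/

open Matrix

noncomputable section

namespace LaurentWitt

variable {F : Type*} [Field F] {D : ℕ}

/-! ### Sesquilinear algebra of v†Aw -/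

section Sesquilinear

variable {m n : Type*} [Fintype n]

/-- The sesquilinear form `v† A w` of a square matrix. -/
def sesq (A : Matrix n n (LaurentRing F D)) (v w : n → LaurentRing F D) : LaurentRing F D :=
  (fun i => bar (v i)) ⬝ᵥ (A *ᵥ w)

variable (A : Matrix n n (LaurentRing F D))

theorem sesq_eq_sum (v w : n → LaurentRing F D) :
    sesq A v w = ∑ i, ∑ j, bar (v i) * A i j * w j := by
  simp only [sesq, dotProduct, mulVec, Finset.mul_sum, mul_assoc]

theorem sesq_add_left (u v w : n → LaurentRing F D) :
    sesq A (u + v) w = sesq A u w + sesq A v w := by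
  simp only [sesq, Pi.add_apply, map_add]
  exact add_dotProduct _ _ _

theorem sesq_add_right (u v w : n → LaurentRing F D) :
    sesq A u (v + w) = sesq A u v + sesq A u w := by
  simp only [sesq, mulVec_add, dotProduct_add]

theorem sesq_smul_left (c : LaurentRing F D) (v w : n → LaurentRing F D) :
    sesq A (c • v) w = bar c * sesq A v w := by
  simp only [sesq_eq_sum, Finset.mul_sum, Pi.smul_apply, smul_eq_mul, map_mul, mul_assoc]

theorem sesq_smul_right (c : LaurentRing F D) (v w : n → LaurentRing F D) :
    sesq A v (c • w) = c * sesq A v w := by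
  simp only [sesq, mulVec_smul, dotProduct_smul, smul_eq_mul]

/-- The form `v† A w` as a linear map in `w`. -/
def sesqRight (v : n → LaurentRing F D) :
    (n → LaurentRing F D) →ₗ[LaurentRing F D] LaurentRing F D where
  toFun := sesq A v
  map_add' := sesq_add_right A v
  map_smul' c w := sesq_smul_right A c v w

@[simp] theorem sesqRight_apply (v w : n → LaurentRing F D) : sesqRight A v w = sesq A v w := rfl

theorem sesq_sum_right {ι : Type*} (s : Finset ι) (v : n → LaurentRing F D)
    (w : ι → n → LaurentRing F D) : sesq A v (∑ i ∈ s, w i) = ∑ i ∈ s, sesq A v (w i) :=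
  map_sum (sesqRight A v) w s

theorem bar_sesq (v w : n → LaurentRing F D) :
    bar (sesq A v w) = sesq (dagger A) w v := by
  simp only [sesq_eq_sum, map_sum, map_mul, bar_bar, dagger_apply]
  rw [Finset.sum_comm]
  exact Finset.sum_congr rfl fun i _ => Finset.sum_congr rfl fun j _ => by ring

theorem sesq_neg_matrix (v w : n → LaurentRing F D) : sesq (-A) v w = -sesq A v w := by
  simp only [sesq, neg_mulVec, dotProduct_neg]

theorem sesq_sum_left {ι : Type*} (s : Finset ι) (v : ι → n → LaurentRing F D)
    (w : n → LaurentRing F D) : sesq A (∑ i ∈ s, v i) w = ∑ i ∈ s, sesq A (v i) w := by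
  apply bar.injective
  rw [bar_sesq, sesq_sum_right, map_sum]
  exact Finset.sum_congr rfl fun i _ => (bar_sesq _ _ _).symm

theorem bar_sesq_of_antihermitian {A : Matrix n n (LaurentRing F D)} (hA : dagger A = -A)
    (v w : n → LaurentRing F D) : bar (sesq A v w) = -sesq A w v := by
  rw [bar_sesq, hA, sesq_neg_matrix]

theorem sesq_sub_dagger_self (v : n → LaurentRing F D) :
    sesq (A - dagger A) v v = sesq A v v - bar (sesq A v v) := by
  rw [bar_sesq]
  simp only [sesq, sub_mulVec, dotProduct_sub]

theorem dagger_mul_mul_apply (E : Matrix n m (LaurentRing F D)) (i j : m) :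
    (dagger E * A * E) i j = sesq A (fun k => E k i) (fun k => E k j) := by
  simp only [sesq_eq_sum, Matrix.mul_apply, dagger_apply, Finset.sum_mul]
  exact Finset.sum_comm

end Sesquilinear

theorem constTerm_sub_bar (g : LaurentRing F D) : constTerm (g - bar g) = 0 := by
  simp [constTerm]

/-! ### Splitting off a hyperbolic plane -/

namespace AntihermitianForm

/-- Writing Ξ = M - M†, take g = v†Mv. This is the evenness property that survives in characteristic
2. -/
theorem exists_sesq_self_eq (X : AntihermitianForm F D) (v : Fin X.dim → LaurentRing F D) :
    ∃ g, sesq X.mat v v = g - bar g := by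
  obtain ⟨M, hM⟩ := exists_sub_dagger X
  exact ⟨_, hM ▸ sesq_sub_dagger_self M v⟩

/-- A unimodular isotropic vector is one half of a hyperbolic pair. -/
theorem exists_hyperbolic_partner (X : AntihermitianForm F D) {v c : Fin X.dim → LaurentRing F D}
    (hc : v ⬝ᵥ c = 1) (hv : sesq X.mat v v = 0) :
    ∃ w, sesq X.mat v w = 1 ∧ sesq X.mat w w = 0 := by
  obtain ⟨N, hN⟩ := X.invertible.exists_right_inv
  -- With w₀ = Ξ⁻¹c̄ the pairing v†Ξw₀ is the involution applied to v · c = 1.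
  set w₀ := N *ᵥ fun i => bar (c i) with hw₀
  have h1 : sesq X.mat v w₀ = 1 := by
    rw [hw₀, sesq, mulVec_mulVec, hN, one_mulVec, ← map_one bar, ← hc]
    simp [dotProduct, map_sum]
  have h2 : sesq X.mat w₀ v = -1 := by
    rw [← neg_eq_iff_eq_neg, ← bar_sesq_of_antihermitian X.antihermitian, h1, map_one]
  obtain ⟨g, hg⟩ := X.exists_sesq_self_eq w₀
  -- Adding g • v leaves the pairing with v unchanged, v being isotropic, and changes w₀†Ξw₀ = g - ḡ
  -- by -g + ḡ.
  refine ⟨w₀ + g • v, ?_, ?_⟩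
  · rw [sesq_add_right, sesq_smul_right, hv, h1]; ring
  · rw [sesq_add_right, sesq_add_left, sesq_add_left, sesq_smul_right, sesq_smul_right,
      sesq_smul_left, sesq_smul_left, hv, h1, h2, hg]; ring

/-- A hyperbolic plane spanned by an isotropic unimodular vector splits off. -/
theorem exists_congruent_dsum_hyperbolic [IsPrincipalIdealRing (LaurentRing F D)]
    (X : AntihermitianForm F D) {v c : Fin X.dim → LaurentRing F D}
    (hc : v ⬝ᵥ c = 1) (hv : sesq X.mat v v = 0) :
    ∃ Y : AntihermitianForm F D, Y.dim < X.dim ∧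
      Congruent X.mat (dsum Y.mat (hyperbolic F D 1)) := by
  obtain ⟨w, hvw, hw⟩ := X.exists_hyperbolic_partner hc hv
  have hwv : sesq X.mat w v = -1 := by
    rw [← neg_eq_iff_eq_neg, ← bar_sesq_of_antihermitian X.antihermitian, hvw, map_one]
  -- The orthogonal complement of the plane spanned by v and w; it is free because R is principal.
  let K := LinearMap.ker ((sesqRight X.mat v).prod (sesqRight X.mat w))
  have hK : ∀ u, u ∈ K ↔ sesq X.mat v u = 0 ∧ sesq X.mat w u = 0 := fun u => by
    simp [K, LinearMap.mem_ker]
  obtain ⟨k, ⟨b⟩⟩ := Submodule.nonempty_basis_of_pid (Pi.basisFun (LaurentRing F D) (Fin X.dim)) K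
  have hbv : ∀ i, sesq X.mat v (b i) = 0 := fun i => ((hK _).1 (b i).2).1
  have hbw : ∀ i, sesq X.mat w (b i) = 0 := fun i => ((hK _).1 (b i).2).2
  have hbv' : ∀ i, sesq X.mat (b i) v = 0 := fun i => by
    rw [← neg_eq_zero, ← bar_sesq_of_antihermitian X.antihermitian, hbv, map_zero]
  have hbw' : ∀ i, sesq X.mat (b i) w = 0 := fun i => by
    rw [← neg_eq_zero, ← bar_sesq_of_antihermitian X.antihermitian, hbw, map_zero]
  let e : Fin k ⊕ (Fin 1 ⊕ Fin 1) → Fin X.dim → LaurentRing F D :=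
    Sum.elim (fun i => (b i : Fin X.dim → LaurentRing F D)) (Sum.elim (fun _ => v) (fun _ => w))
  let E : Matrix (Fin X.dim) (Fin k ⊕ (Fin 1 ⊕ Fin 1)) (LaurentRing F D) :=
    Matrix.of fun i j => e j i
  have hE : ∀ y, E *ᵥ y = ∑ i, y (Sum.inl i) • (b i : Fin X.dim → LaurentRing F D) +
      (y (Sum.inr (Sum.inl 0)) • v + y (Sum.inr (Sum.inr 0)) • w) := fun y => by
    ext1 j
    simp [E, e, mulVec, dotProduct, mul_comm]
  have hsurj : Function.Surjective E.mulVec := fun u => by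
    -- Orthogonal projection of u to K; the signs reflect v†Ξw = 1 and w†Ξv = -1.
    have hu : u + (sesq X.mat w u • v - sesq X.mat v u • w) ∈ K := by
      rw [hK, sub_eq_add_neg, ← neg_smul]
      simp only [sesq_add_right, sesq_smul_right, hv, hw, hvw, hwv]
      constructor <;> ring
    refine ⟨Sum.elim (b.repr ⟨_, hu⟩)
      (Sum.elim (fun _ => -sesq X.mat w u) (fun _ => sesq X.mat v u)), ?_⟩
    have hs := congrArg Subtype.val (b.sum_repr ⟨_, hu⟩)
    rw [AddSubmonoidClass.coe_finsetSum] at hs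
    simp only [Submodule.coe_smul] at hs
    rw [hE]
    simp only [Sum.elim_inl, Sum.elim_inr]
    rw [hs, neg_smul]
    abel
  have hinj : Function.Injective E.mulVec := by
    refine (injective_iff_map_eq_zero E.mulVecLin).2 fun y hy => ?_
    rw [mulVecLin_apply] at hy
    have hy' := hy
    rw [hE] at hy
    have hv0 : sesq X.mat v (E *ᵥ y) = 0 := by rw [hy']; exact map_zero (sesqRight X.mat v)
    have hw0 : sesq X.mat w (E *ᵥ y) = 0 := by rw [hy']; exact map_zero (sesqRight X.mat w)
    rw [hE] at hv0 hw0
    simp only [sesq_add_right, sesq_sum_right, sesq_smul_right, hbv, hbw, hv, hw, hvw, hwv,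
      mul_zero, Finset.sum_const_zero, zero_add, add_zero, mul_one, mul_neg, neg_eq_zero] at hv0 hw0
    rw [hv0, hw0, zero_smul, zero_smul, add_zero, add_zero] at hy
    have hy0 := Fintype.linearIndependent_iff.1 b.linearIndependent (fun i => y (Sum.inl i))
      (Subtype.ext (by simpa [AddSubmonoidClass.coe_finsetSum] using hy))
    ext1 j
    rcases j with j | j | j
    · exact hy0 j
    · rw [Subsingleton.elim j 0]; exact hw0
    · rw [Subsingleton.elim j 0]; exact hv0
  -- Surjectivity gives a right inverse; injectivity applied to E(E'E) = E makes it two-sided.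
  obtain ⟨E', hEE'⟩ := mulVec_surjective_iff_exists_right_inverse.1 hsurj
  have hE'E : E' * E = 1 := by
    refine Matrix.ext_of_mulVec_single fun j => hinj ?_
    rw [mulVec_mulVec, ← Matrix.mul_assoc, hEE', Matrix.one_mul, one_mulVec]
  let B : Matrix (Fin k) (Fin k) (LaurentRing F D) := Matrix.of fun i j => sesq X.mat (b i) (b j)
  have hcong : dagger E * X.mat * E = dsum B (hyperbolic F D 1) := by
    ext1 i j
    rw [dagger_mul_mul_apply]
    change sesq X.mat (e i) (e j) = _
    rcases i with i | i | i <;> rcases j with j | j | j <;>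
      simp [e, B, dsum, hyperbolic, hv, hw, hvw, hwv, hbv, hbw, hbv', hbw'] <;>
      rw [Subsingleton.elim i j, Matrix.one_apply_eq]
  obtain ⟨N, hN⟩ := X.invertible.exists_right_inv
  have hunit : IsUnit (dsum B (hyperbolic F D 1)) := by
    refine IsUnit.of_mul_eq_one (E' * N * dagger E') ?_
    rw [← hcong]
    calc dagger E * X.mat * E * (E' * N * dagger E')
        = dagger E * (X.mat * (E * E') * N) * dagger E' := by simp only [Matrix.mul_assoc]
      _ = dagger (E' * E) := by rw [hEE', Matrix.mul_one, hN, Matrix.mul_one, dagger_mul]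
      _ = 1 := by rw [hE'E, dagger_one]
  refine ⟨⟨k, B, ?_, ?_, ?_⟩, ?_, E, E', hEE', hE'E, hcong⟩
  · ext1 i j
    exact bar_sesq_of_antihermitian X.antihermitian _ _
  · rw [Matrix.isUnit_iff_isUnit_det, dsum, det_fromBlocks_zero₁₂] at hunit
    exact (Matrix.isUnit_iff_isUnit_det _).2 (isUnit_of_mul_isUnit_left hunit)
  · intro i
    obtain ⟨g, hg⟩ := X.exists_sesq_self_eq (b i)
    change constTerm (sesq X.mat (b i) (b i)) = 0
    rw [hg, constTerm_sub_bar]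
  -- An invertible matrix over a nontrivial commutative ring is square, so the dimension of X is k +
  -- 2.
  · have := Matrix.square_of_invertible E E' hEE' hE'E
    simp at this
    change k < X.dim
    omega

end AntihermitianForm

/-! ### Reduction of triviality to isotropy -/

/-- A nonzero vector over a Bézout domain is a multiple of a unimodular one. -/
theorem exists_eq_smul_unimodular {R ι : Type*} [CommRing R] [IsDomain R] [IsBezout R] [Fintype ι]
    {v : ι → R} (hv : v ≠ 0) : ∃ (g : R) (u c : ι → R), g ≠ 0 ∧ v = g • u ∧ u ⬝ᵥ c = 1 := by
  -- g is a gcd of the entries; u consists of the cofactors and c of Bézout coefficients, and g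
  -- cancels from g(u · c) = g.
  obtain ⟨g, hg⟩ := (IsBezout.isPrincipal_of_FG (Ideal.span (Set.range v))
    (Submodule.fg_span (Set.finite_range v))).principal
  have hmem : ∀ i, v i ∈ Ideal.span {g} := fun i => by
    rw [← Ideal.submodule_span_eq, ← hg]
    exact Ideal.subset_span ⟨i, rfl⟩
  choose u hu using fun i => Ideal.mem_span_singleton'.1 (hmem i)
  have hg' : g ∈ Ideal.span (Set.range v) := by
    rw [hg]; exact Submodule.mem_span_singleton_self g
  obtain ⟨c, hc⟩ := (Ideal.mem_span_range_iff_exists_fun).1 hg'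
  have hg0 : g ≠ 0 := by
    rintro rfl
    exact hv (funext fun i => by simp [← hu i])
  refine ⟨g, u, c, hg0, funext fun i => by simp [← hu i, mul_comm], mul_left_cancel₀ hg0 ?_⟩
  rw [mul_one]
  conv_rhs => rw [← hc]
  rw [dotProduct, Finset.mul_sum]
  exact Finset.sum_congr rfl fun i _ => by rw [← hu i]; ring

/-- If all nonempty forms are isotropic, the Witt group is trivial. -/
theorem subsingleton_wittGroup_of_isotropic [IsDomain (LaurentRing F D)]
    [IsPrincipalIdealRing (LaurentRing F D)]
    (h : ∀ X : AntihermitianForm F D, X.dim ≠ 0 → ∃ v ≠ 0, sesq X.mat v v = 0) :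
    Subsingleton (WittGroup F D) := by
  have key : ∀ (d : ℕ) (X : AntihermitianForm F D), X.dim = d →
      StablyEquivalent X (zeroForm F D) := by
    intro d
    induction d using Nat.strong_induction_on with
    | _ d ih =>
      intro X hX
      by_cases h0 : X.dim = 0
      · have : IsEmpty (Fin X.dim) := h0 ▸ Fin.isEmpty
        have : IsEmpty (Fin (zeroForm F D).dim) := Fin.isEmpty
        exact StablyEquivalent.of_congruent
          ⟨0, 0, Subsingleton.elim _ _, Subsingleton.elim _ _, Subsingleton.elim _ _⟩
      · obtain ⟨v, hv0, hv⟩ := h X h0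
        obtain ⟨g, u, c, hg, rfl, hc⟩ := exists_eq_smul_unimodular hv0
        rw [sesq_smul_left, sesq_smul_right] at hv
        -- The value at g • u is ḡg times the value at u, and ḡg ≠ 0 in a domain.
        have hu : sesq X.mat u u = 0 := by
          simpa [hg] using hv
        obtain ⟨Y, hYX, hY⟩ := X.exists_congruent_dsum_hyperbolic hc hu
        have : IsEmpty (Fin 0 ⊕ Fin 0) := inferInstance
        exact StablyEquivalent.trans
          ⟨0, 1, ((congruent_dsum_comm _ _).trans (congruent_dsum_empty _ _)).trans hY⟩
          (ih _ (hX ▸ hYX) Y rfl)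
  refine ⟨?_⟩
  rintro ⟨X⟩ ⟨Y⟩
  exact Quotient.sound ((key _ X rfl).trans (key _ Y rfl).symm)

/-! ### The case D = 0 -/

section NoVariables

theorem algebraMap_surjective_of_noVariables :
    Function.Surjective (algebraMap F (LaurentRing F 0)) := fun f =>
  ⟨f.coeff 0, by
    refine AddMonoidAlgebra.coeff_injective (Finsupp.ext fun a => ?_)
    rw [Subsingleton.elim a 0]
    simp⟩

instance : IsPrincipalIdealRing (LaurentRing F 0) :=
  IsPrincipalIdealRing.of_surjective (algebraMap F (LaurentRing F 0))
    algebraMap_surjective_of_noVariables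

theorem bar_noVariables (f : LaurentRing F 0) : bar f = f := by
  refine AddMonoidAlgebra.coeff_injective (Finsupp.ext fun a => ?_)
  rw [coeff_bar, Subsingleton.elim (-a) a]

theorem subsingleton_wittGroup_zero : Subsingleton (WittGroup F 0) := by
  refine subsingleton_wittGroup_of_isotropic fun X hX => ?_
  refine ⟨Pi.single ⟨0, Nat.pos_of_ne_zero hX⟩ 1, by simp, ?_⟩
  obtain ⟨g, hg⟩ := X.exists_sesq_self_eq (Pi.single ⟨0, Nat.pos_of_ne_zero hX⟩ 1)
  rw [hg, bar_noVariables, sub_self]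

end NoVariables

/-! ### Evaluation at x = 1, which is invariant under the involution -/

section Augmentation

/-- The evaluation of Laurent polynomials at `x₁ = ⋯ = x_D = 1`. -/
def augmentation : LaurentRing F D →ₐ[F] F := AddMonoidAlgebra.lift F F (Fin D → ℤ) 1

@[simp] theorem augmentation_bar (f : LaurentRing F D) : augmentation (bar f) = augmentation f := by
  have : (augmentation (F := F) (D := D)).comp bar.toAlgHom =
      augmentation := by
    ext a
    simp [augmentation, bar]
  exact DFunLike.congr_fun this f

end Augmentation

/-! ### One variable: principality, units, and dimension two -/

section OneVariable

/-- Laurent polynomials in one variable are Mathlib's `LaurentPolynomial`. -/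
def toLaurentPolynomial : LaurentRing F 1 ≃ₐ[F] LaurentPolynomial F :=
  AddMonoidAlgebra.domCongr F F
    (LinearEquiv.funUnique (Fin 1) ℤ ℤ).toAddEquiv

/-- Each ideal of a localization is the extension of its contraction, so the image of a generator of
the contraction generates it. -/
theorem isPrincipalIdealRing_of_isLocalization {R S : Type*} [CommRing R] [IsPrincipalIdealRing R]
    [CommRing S] [Algebra R S] (M : Submonoid R) [IsLocalization M S] : IsPrincipalIdealRing S :=
  ⟨fun I => by
    obtain ⟨g, hg⟩ := (IsPrincipalIdealRing.principal (I.under R)).principal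
    refine ⟨algebraMap R S g, ?_⟩
    rw [← IsLocalization.map_under M S I, hg, Ideal.submodule_span_eq, Ideal.map_span,
      Set.image_singleton, Ideal.submodule_span_eq]⟩

instance : IsPrincipalIdealRing (LaurentPolynomial F) :=
  isPrincipalIdealRing_of_isLocalization (Submonoid.powers (Polynomial.X : Polynomial F))

instance : IsPrincipalIdealRing (LaurentRing F 1) :=
  IsPrincipalIdealRing.of_surjective (toLaurentPolynomial (F := F)).symm
    (toLaurentPolynomial (F := F)).symm.surjective

-- Clearing denominators in u and u⁻¹ gives polynomials p, q whose product is a power of X; since X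
-- is prime, p is a constant times a power of X.
open LaurentPolynomial in
theorem exists_C_mul_T_of_isUnit {u : LaurentPolynomial F} (hu : IsUnit u) :
    ∃ (c : F) (k : ℤ), u = C c * T k := by
  obtain ⟨w, hw⟩ := hu.exists_right_inv
  obtain ⟨n, p, hp⟩ := u.exists_T_pow
  obtain ⟨m, q, hq⟩ := w.exists_T_pow
  have hpq : p * q = Polynomial.X ^ (n + m) := by
    apply Polynomial.toLaurent_injective
    rw [map_mul, hp, hq, Polynomial.toLaurent_X_pow, Nat.cast_add, T_add]
    linear_combination (T (n : ℤ) * T (m : ℤ)) * hw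
  obtain ⟨i, -, hi⟩ := (dvd_prime_pow Polynomial.prime_X _).1 (Dvd.intro _ hpq)
  obtain ⟨r, hr⟩ := hi.symm
  obtain ⟨c, -, hc⟩ := Polynomial.isUnit_iff.1 r.isUnit
  refine ⟨c, i - n, ?_⟩
  have hu' : u = Polynomial.toLaurent p * T (-n) := by
    rw [hp, mul_assoc, ← T_add, add_neg_cancel, T_zero, mul_one]
  rw [hu', ← hr, ← hc, map_mul, Polynomial.toLaurent_X_pow, Polynomial.toLaurent_C, sub_eq_add_neg,
    T_add]
  ring

/-- A symmetric unit is a constant. -/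
theorem eq_algebraMap_of_isUnit_of_bar_eq {u : LaurentRing F 1} (hu : IsUnit u) (hb : bar u = u) :
    u = algebraMap F _ (augmentation u) := by
  obtain ⟨c, k, hck⟩ := exists_C_mul_T_of_isUnit (hu.map toLaurentPolynomial)
  obtain ⟨a, rfl⟩ : ∃ a, u = AddMonoidAlgebra.single a c := by
    refine ⟨(LinearEquiv.funUnique (Fin 1) ℤ ℤ).toAddEquiv.symm k, ?_⟩
    apply (toLaurentPolynomial (F := F)).injective
    rw [hck, ← LaurentPolynomial.single_eq_C_mul_T, toLaurentPolynomial,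
      AddMonoidAlgebra.domCongr_single, AddEquiv.apply_symm_apply]
  have hc : c ≠ 0 := by
    rintro rfl
    simp at hu
  have h1 : (AddMonoidAlgebra.single (-a) c : LaurentRing F 1) = AddMonoidAlgebra.single a c := by
    rw [← hb]
    simp [bar]
  have ha : a = 0 := by
    have h2 := (AddMonoidAlgebra.single_left_inj hc).1 h1
    exact self_eq_neg.1 h2.symm
  subst ha
  simp [augmentation]

/-- Writing a, b for the first row, completing the square gives v†Av = a((y+b)·bar(y+b) - det A) for
v = (y, a). It therefore suffices that det A is a norm. It is a symmetric unit, hence a constant,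
and its value at x = 1 is e² because a vanishes there; so y = e - b works. -/
theorem exists_isotropic_of_dim_two {A : Matrix (Fin 2) (Fin 2) (LaurentRing F 1)}
    (hA : dagger A = -A) (hu : IsUnit A) (h0 : augmentation (A 0 0) = 0) :
    ∃ v ≠ 0, sesq A v v = 0 := by
  have hbar : ∀ i j, bar (A i j) = -A j i := fun i j => congrFun (congrFun hA j) i
  by_cases ha : A 0 0 = 0
  · exact ⟨Pi.single 0 1, by simp, by simp [sesq_eq_sum, ha]⟩
  have hdet : IsUnit A.det := (Matrix.isUnit_iff_isUnit_det _).1 hu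
  have hdet' := eq_algebraMap_of_isUnit_of_bar_eq hdet (by
    rw [det_fin_two, map_sub, map_mul, map_mul, hbar, hbar, hbar, hbar]; ring)
  set e := augmentation (A 0 1)
  have he : augmentation A.det = e ^ 2 := by
    have h10 : augmentation (A 1 0) = -e := by
      rw [← augmentation_bar, hbar, map_neg]
    rw [det_fin_two, map_sub, map_mul, map_mul, h0, h10]
    ring
  rw [he, det_fin_two, map_pow] at hdet'
  refine ⟨![algebraMap F _ e - A 0 1, A 0 0], fun h => ha (congrFun h 1), ?_⟩
  simp only [sesq_eq_sum, Fin.sum_univ_two, cons_val_zero, cons_val_one, map_sub, hbar,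
    AlgEquiv.commutes]
  linear_combination (-A 0 0) * hdet'

end OneVariable

/-! ### Common zeros of quadratic forms over a finite field -/

section ChevalleyWarning

/-- More variables than twice the number of quadratic forms force a common nontrivial zero. -/
theorem exists_common_zero_of_quadratic {σ ι : Type*} [Finite F] [Fintype σ]
    (s : Finset ι) (q : ι → σ → σ → F) (h : 2 * s.card < Fintype.card σ) :
    ∃ y : σ → F, y ≠ 0 ∧ ∀ a ∈ s, ∑ i, ∑ j, y i * y j * q a i j = 0 := by
  classical
  have := Fintype.ofFinite F
  obtain ⟨p, hp⟩ := CharP.exists F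
  have hprime : p.Prime :=
    (CharP.char_is_prime_or_zero F p).resolve_right (CharP.char_ne_zero_of_finite F p)
  let f : ι → MvPolynomial σ F := fun a =>
    ∑ i, ∑ j, MvPolynomial.X i * MvPolynomial.X j * MvPolynomial.C (q a i j)
  have heval : ∀ a y, MvPolynomial.eval y (f a) = ∑ i, ∑ j, y i * y j * q a i j := fun a y => by
    simp [f, map_sum]
  have hdeg : ∀ a, (f a).totalDegree ≤ 2 := fun a => by
    refine MvPolynomial.totalDegree_finsetSum_le fun i _ =>
      MvPolynomial.totalDegree_finsetSum_le fun j _ => ?_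
    refine (MvPolynomial.totalDegree_mul _ _).trans ?_
    rw [MvPolynomial.totalDegree_C, add_zero]
    refine (MvPolynomial.totalDegree_mul _ _).trans ?_
    rw [MvPolynomial.totalDegree_X, MvPolynomial.totalDegree_X]
  have hlt : ∑ a ∈ s, (f a).totalDegree < Fintype.card σ := by
    refine lt_of_le_of_lt (Finset.sum_le_card_nsmul s _ 2 fun a _ => hdeg a) ?_
    rw [smul_eq_mul, mul_comm]
    exact h
  have hzero : ∀ a ∈ s, MvPolynomial.eval 0 (f a) = 0 := fun a _ => by
    rw [heval]
    simp
  -- The characteristic divides the number of solutions; as 0 is one of them, there are at least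
  -- two.
  have hdvd := char_dvd_card_solutions_of_sum_lt p hlt
  have hcard := hprime.one_lt.trans_le (Nat.le_of_dvd
    (Fintype.card_pos_iff.2 ⟨0, hzero⟩) hdvd)
  obtain ⟨⟨y, hy⟩, hne⟩ := Fintype.exists_ne_of_one_lt_card hcard ⟨0, hzero⟩
  exact ⟨y, fun h0 => hne (Subtype.ext h0), fun a ha => by rw [← heval]; exact hy a ha⟩

end ChevalleyWarning

/-! ### One variable over a finite field -/

section OneVariable

/-- The exponent of `x^a`. -/
abbrev expo (a : ℤ) : Fin 1 → ℤ := fun _ => a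

/-- Only an upper bound on exponents is recorded: for an antihermitian value, the coefficients at
negative exponents are determined by those at positive ones. -/
theorem exists_degree_bound {ι : Type*} [Finite ι] (f : ι → LaurentRing F 1) :
    ∃ d : ℕ, ∀ i, ∀ a : ℤ, d < a → (f i).coeff (expo a) = 0 := by
  classical
  cases nonempty_fintype ι
  refine ⟨(Finset.univ.biUnion fun i => (f i).coeff.support).sup fun a => (a 0).natAbs,
    fun i a ha => ?_⟩
  by_contra h
  have := Finset.le_sup (f := fun a : Fin 1 → ℤ => (a 0).natAbs)
    (Finset.mem_biUnion (t := fun i => (f i).coeff.support) |>.2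
      ⟨i, Finset.mem_univ i, Finsupp.mem_support_iff.2 h⟩)
  simp only [expo] at this
  omega

theorem exists_isotropic_of_three_le_dim [Finite F] (X : AntihermitianForm F 1) (h : 3 ≤ X.dim) :
    ∃ v ≠ 0, sesq X.mat v v = 0 := by
  classical
  obtain ⟨d, hd⟩ := exists_degree_bound fun p : Fin X.dim × Fin X.dim => X.mat p.1 p.2
  -- The monomial vectors x^j times a standard basis vector, 0 ≤ j ≤ 2d; the unknowns y are the
  -- coefficients of v on them.
  let e : Fin X.dim × Fin (2 * d + 1) → Fin X.dim → LaurentRing F 1 := fun p =>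
    Pi.single p.1 (AddMonoidAlgebra.single (expo p.2) 1)
  have he : ∀ p q, sesq X.mat (e p) (e q) =
      AddMonoidAlgebra.single (-expo p.2) 1 * X.mat p.1 q.1 * AddMonoidAlgebra.single (expo q.2) 1 :=
    fun p q => by
      rw [sesq_eq_sum, Fintype.sum_eq_single p.1, Fintype.sum_eq_single q.1]
      · simp [e, bar]
      · intro j hj
        simp [e, hj]
      · intro i hi
        simp [e, hi]
  -- There are 3d equations and at least 3(2d+1) = 6d + 3 unknowns. The degree 2d is large enough
  -- for this count, and it limits the exponents of v†Ξv to 2d + d.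
  obtain ⟨y, hy0, hy⟩ := exists_common_zero_of_quadratic (Finset.Icc (1 : ℤ) (3 * d))
    (fun a p q => (sesq X.mat (e p) (e q)).coeff (expo a)) (by
      rw [Int.card_Icc, Fintype.card_prod, Fintype.card_fin, Fintype.card_fin]
      have := Nat.mul_le_mul_right (2 * d + 1) h
      omega)
  let v : Fin X.dim → LaurentRing F 1 := ∑ p, algebraMap F (LaurentRing F 1) (y p) • e p
  have hv : sesq X.mat v v = ∑ p, ∑ q, (y p * y q) • sesq X.mat (e p) (e q) := by
    simp only [v, sesq_sum_left, sesq_sum_right]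
    rw [Finset.sum_comm]
    refine Finset.sum_congr rfl fun p _ => Finset.sum_congr rfl fun q _ => ?_
    rw [sesq_smul_left, sesq_smul_right, AlgEquiv.commutes, Algebra.smul_def, map_mul, mul_assoc]
  refine ⟨v, fun hv0 => hy0 (funext fun p => ?_), ?_⟩
  -- Each unknown is recovered as a coefficient of v, so a nonzero solution gives a nonzero vector.
  · have hp : (v p.1).coeff (expo p.2) = y p := by
      simp only [v, e, Finset.sum_apply, Pi.smul_apply, AddMonoidAlgebra.coeff_sum,
        Finsupp.finsetSum_apply]
      rw [Fintype.sum_eq_single p]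
      · simp
      · intro q hq
        by_cases h1 : q.1 = p.1
        · have h2 : expo q.2 ≠ expo p.2 := fun h2 => hq (Prod.ext h1 (Fin.ext (by
            exact_mod_cast congrFun h2 0)))
          simp [← h1, h2]
        · simp [Pi.single_eq_of_ne (Ne.symm h1)]
    rw [← hp, hv0]
    simp
  · obtain ⟨g, hg⟩ := X.exists_sesq_self_eq v
    have hpos : ∀ a : ℤ, 0 < a → (sesq X.mat v v).coeff (expo a) = 0 := by
      intro a ha
      have hcoeff : (sesq X.mat v v).coeff (expo a) =
          ∑ p, ∑ q, y p * y q * (sesq X.mat (e p) (e q)).coeff (expo a) := by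
        rw [hv]
        simp
      rw [hcoeff]
      by_cases ha' : a ≤ 3 * d
      · exact hy a (Finset.mem_Icc.2 ⟨ha, ha'⟩)
      -- The coefficient of x^a in x^{-p}Ξx^{q} is that of x^{a-q+p} in Ξ, and a - q + p > 3d - 2d =
      -- d.
      · refine Finset.sum_eq_zero fun p _ => Finset.sum_eq_zero fun q _ => ?_
        rw [he, AddMonoidAlgebra.coeff_mul_single_eq_coeff_mul (expo (a - q.2)),
          AddMonoidAlgebra.coeff_single_mul_eq_mul_coeff (expo (a - q.2 + p.2)),
          hd (p.1, q.1), mul_zero, zero_mul, mul_zero]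
        · have := q.2.isLt
          omega
        · intro b _
          rw [funext_iff, funext_iff]
          simp only [Pi.add_apply, Pi.neg_apply, expo]
          exact forall_congr' fun _ => by omega
        · intro b _
          rw [funext_iff, funext_iff]
          simp only [Pi.add_apply, expo]
          exact forall_congr' fun _ => by omega
    have hneg : ∀ a, (sesq X.mat v v).coeff (-a) = -(sesq X.mat v v).coeff a := fun a => by
      rw [← coeff_bar, bar_sesq_of_antihermitian X.antihermitian, AddMonoidAlgebra.coeff_neg,
        Finsupp.neg_apply]
    ext a
    obtain ⟨a, rfl⟩ : ∃ b, a = expo b := ⟨a 0, funext fun i => by rw [Subsingleton.elim i 0]⟩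
    -- Negative exponents follow from antihermiticity, the constant term from the form g - ḡ.
    rcases lt_trichotomy a 0 with ha | rfl | ha
    · have h1 := hneg (expo (-a))
      rw [hpos (-a) (by omega), show -expo (-a) = expo a from funext fun _ => neg_neg a] at h1
      simpa using h1
    · rw [hg]
      exact constTerm_sub_bar g
    · exact hpos a ha

theorem exists_isotropic_of_finite [Finite F] (X : AntihermitianForm F 1) (h : X.dim ≠ 0) :
    ∃ v ≠ 0, sesq X.mat v v = 0 := by
  rcases Nat.lt_or_ge X.dim 3 with hlt | hge
  · obtain ⟨n, A, hA, hu, h0⟩ := X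
    have haug : ∀ i, augmentation (A i i) = 0 := fun i => by
      obtain ⟨g, hg⟩ := exists_sub_bar (A i i) (congrFun (congrFun hA i) i) (h0 i)
      rw [hg, map_sub, augmentation_bar, sub_self]
    change n < 3 at hlt
    change n ≠ 0 at h
    obtain rfl | rfl : n = 1 ∨ n = 2 := by omega
    -- A 1 × 1 form would have a unit entry vanishing at x = 1, which is impossible.
    · have := ((Matrix.isUnit_iff_isUnit_det _).1 hu).map (augmentation (F := F) (D := 1))
      rw [det_fin_one, haug] at this
      exact absurd this not_isUnit_zero
    · exact exists_isotropic_of_dim_two hA hu (haug 0)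
  · exact exists_isotropic_of_three_le_dim X hge

theorem subsingleton_wittGroup_one [Finite F] : Subsingleton (WittGroup F 1) :=
  subsingleton_wittGroup_of_isotropic exists_isotropic_of_finite

end OneVariable

end LaurentWitt

end

theorem mainTheorem5 :
    (∀ (F : Type*) [Field F], Subsingleton (LaurentWitt.WittGroup F 0)) ∧
    (∀ (F : Type*) [Field F], Finite F → Subsingleton (LaurentWitt.WittGroup F 1)) :=
  ⟨fun _ _ => LaurentWitt.subsingleton_wittGroup_zero,
    fun _ _ _ => LaurentWitt.subsingleton_wittGroup_one⟩
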